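/- Let $H$ be a finite non-empty hypergraph (multiple edges are allowed, and $H$ need not be connected) with vertex set $V(H)$ and edge set $E(H)$. Suppose $H$ is $(d,r)$-regular, i.e. every vertex lies in exactly $d\ge 1$ edges and every edge has exactly $r\ge 2$ vertices. The eigenvalues of $H$ are those of its adjacency matrix $A(H)$, whose $(u,v)$ entry is the number of edges containing both $u$ and $v$ if $u\ne v$, and $0$ if $u=v$. The incidence graph $B_H$ is the bipartite graph on $V(H)\cup E(H)$ in which $v\in V(H)$ and $e\in E(H)$ are adjacent iff $v\in e$. The matching polynomial of a graph $G$ on $n$ vertices is $\mu_G(x)=\sum_{i\ge 0}(-1)^i m_i x^{n-2i}$, where $m_i$ is the number of sets of $i$ pairwise vertex-disjoint edges of $G$; all its roots are real. A $2$-covering of $H$ is a hypergraph $\bar H$ with a covering projection to $H$: a surjection $\varpi:V(\bar H)\to V(H)$ mapping edges to edges, together with the induced map on edges, such that for each vertex $\bar v$ of $\bar H$ the edges of $\bar H$ at $\bar v$ are mapped bijectively to the edges of $H$ at $\varpi(\bar v)$, each edge $e$ of $\bar H$ is mapped bijectively onto the edge $\varpi(e)$, and every vertex and every edge of $H$ has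 exactly two preimages. As multisets, the spectrum of $\bar H$ contains that of $H$; the remaining $|V(H)|$ eigenvalues of $\bar H$ are called new. If $|V(H)|>|E(H)|$, then $|V(H)|-|E(H)|$ of the new eigenvalues are equal to $-d$, and these are called obvious (if $|V(H)|\le|E(H)|$, there are no obvious eigenvalues). All remaining new eigenvalues, including any further copies of $-d$, are called non-obvious. **Theorem.** Let $\tau_H=\min\{|V(H)|,|E(H)|\}$, and let $\mu_{\tau_H}(B_H)$ be the $\tau_H$-th largest root of $\mu_{B_H}(x)$, roots being counted with multiplicity. If $$\mu_{\tau_H}(B_H)\ \ge\ \left|\sqrt{d-1}-\sqrt{r-1}\right|,$$ then $H$ has a left-sided Ramanujan $2$-covering, i.e. a $2$-covering $\bar H$ all of whose non-obvious new eigenvalues $\lambda$ satisfy $$\lambda\ \ge\ r-2-2\sqrt{(d-1)(r-1)}.$$ -/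

import Mathlib

universe u v u' v'

/-- A hypergraph with vertex set `V` and edges indexed by `E`; each edge is a finite set of
vertices. Since the edges are indexed, multiple edges are allowed; a hypergraph without multiple
edges is one for which `edge` is injective. -/
structure MultiHypergraph (V : Type u) (E : Type v) where
  /-- The set of vertices of an edge. -/
  edge : E → Finset V

namespace MultiHypergraph

variable {V : Type u} {E : Type v} {V' : Type u'} {E' : Type v'}

/-- `E_H(v)`, the set of edges containing the vertex `v`. -/
def edgesAt (H : MultiHypergraph V E) (v : V) : Set E := {e | v ∈ H.edge e}

/-- `H` is `(d, r)`-regular: every vertex has degree `d` and every edge has `r` vertices, where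
`r ≥ 2`. -/
structure IsRegular (H : MultiHypergraph V E) (d r : ℕ) : Prop where
  two_le : 2 ≤ r
  degree_eq : ∀ v : V, (H.edgesAt v).ncard = d
  card_edge : ∀ e : E, (H.edge e).card = r

/-- The adjacency matrix: the entry at `u ≠ v` is the number of edges containing both `u` and `v`,
and the diagonal entries are `0`. -/
def adjMatrix [Fintype E] [DecidableEq V] (H : MultiHypergraph V E) : Matrix V V ℝ :=
  Matrix.of fun u v =>
    if u = v then 0
    else ((Finset.univ.filter fun e : E => u ∈ H.edge e ∧ v ∈ H.edge e).card : ℝ)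

/-- The multiset of eigenvalues of the (real symmetric) adjacency matrix, with multiplicities. -/
noncomputable def spec [Fintype V] [DecidableEq V] [Fintype E] (H : MultiHypergraph V E) :
    Multiset ℝ :=
  H.adjMatrix.charpoly.roots

/-- The incidence graph `B_H`: the bipartite graph on the vertices and edges of `H` in which `v`
and `e` are adjacent exactly when `v ∈ e`. -/
def incidenceGraph (H : MultiHypergraph V E) : SimpleGraph (V ⊕ E) where
  Adj x y := (∃ v e, v ∈ H.edge e ∧ x = Sum.inl v ∧ y = Sum.inr e) ∨
    (∃ v e, v ∈ H.edge e ∧ x = Sum.inr e ∧ y = Sum.inl v)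
  symm := ⟨by
    rintro x y (⟨v, e, h, hx, hy⟩ | ⟨v, e, h, hx, hy⟩)
    · exact Or.inr ⟨v, e, h, hy, hx⟩
    · exact Or.inl ⟨v, e, h, hy, hx⟩⟩
  loopless := ⟨by
    rintro x (⟨v, e, _, hx, hy⟩ | ⟨v, e, _, hx, hy⟩) <;> simp [hx] at hy⟩

/-- A covering projection from `H'` to `H`. It is a surjective map on vertices that maps edges to
edges (as multiple edges are allowed, the induced map on edges is part of the data), that restricts
to a bijection from the edges at `v'` to the edges at the image of `v'`, for every vertex `v'`, and
that restricts to a bijection from each edge onto its image. -/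
structure Covering (H' : MultiHypergraph V' E') (H : MultiHypergraph V E) where
  /-- The map on vertices. -/
  onV : V' → V
  /-- The induced map on edges. -/
  onE : E' → E
  image_edge : ∀ e' : E', onV '' (H'.edge e' : Set V') = (H.edge (onE e') : Set V)
  surjective : Function.Surjective onV
  bijOn_edgesAt : ∀ v' : V', Set.BijOn onE (H'.edgesAt v') (H.edgesAt (onV v'))
  bijOn_edge : ∀ e' : E', Set.BijOn onV (H'.edge e' : Set V') (H.edge (onE e') : Set V)

/-- A covering projection is `k`-fold if each vertex and each edge has exactly `k` preimages. -/
structure Covering.IsFold {H' : MultiHypergraph V' E'} {H : MultiHypergraph V E}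
    (p : Covering H' H) (k : ℕ) : Prop where
  card_fiber_vertex : ∀ v : V, {v' : V' | p.onV v' = v}.ncard = k
  card_fiber_edge : ∀ e : E, {e' : E' | p.onE e' = e}.ncard = k

/-- The multiset of obvious eigenvalues of a `d`-regular uniform hypergraph `H`: the value `-d` with
multiplicity `|V(H)| - |E(H)|` if `|V(H)| > |E(H)|`, and none otherwise (the natural number
subtraction is `0` then). -/
def obvious [Fintype V] [Fintype E] (_H : MultiHypergraph V E) (d : ℕ) : Multiset ℝ :=
  Multiset.replicate (Fintype.card V - Fintype.card E) (-(d : ℝ))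

/-- `H'` is a left-sided Ramanujan `2`-covering of the `(d, r)`-regular hypergraph `H` by means of
the covering projection `p`. Here `new` is the multiset of new eigenvalues (the spectrum of `H'` is
the multiset union of the spectrum of `H` and `new`), and `rest` is the multiset of the non-obvious
ones among them. The obvious eigenvalues of `H'` number twice as many as those of `H`; removing the
old ones leaves as many obvious new eigenvalues as `H` has. -/
def Covering.IsLeftSidedRamanujan [Fintype V] [DecidableEq V] [Fintype E]
    [Fintype V'] [DecidableEq V'] [Fintype E']
    {H' : MultiHypergraph V' E'} {H : MultiHypergraph V E} (p : Covering H' H) (d r : ℕ) : Prop :=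
  p.IsFold 2 ∧
  ∃ new rest : Multiset ℝ,
    H'.spec = H.spec + new ∧
    new = H.obvious d + rest ∧
    ∀ x ∈ rest, (r : ℝ) - 2 - 2 * Real.sqrt (((d : ℝ) - 1) * ((r : ℝ) - 1)) ≤ x

/-- `τ_H`, the minimum of the numbers of vertices and edges. -/
def tau [Fintype V] [Fintype E] (_H : MultiHypergraph V E) : ℕ :=
  min (Fintype.card V) (Fintype.card E)

end MultiHypergraph

/-- The number `m_i` of `i`-matchings of a graph: sets of `i` edges, no two of which share a
vertex. -/
noncomputable def numMatchings {W : Type u} (G : SimpleGraph W) (i : ℕ) : ℕ :=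
  {M : Finset (Sym2 W) | M.card = i ∧ (∀ e ∈ M, e ∈ G.edgeSet) ∧
    ∀ e ∈ M, ∀ f ∈ M, e ≠ f → ∀ w : W, ¬ (w ∈ e ∧ w ∈ f)}.ncard

/-- The matching polynomial `∑ i, (-1)^i m_i x^(n - 2 i)`, where `n` is the number of vertices.
Every matching has at most `n / 2` edges, so the sum stops there. -/
noncomputable def matchingPolynomial {W : Type u} [Fintype W] (G : SimpleGraph W) :
    Polynomial ℝ :=
  ∑ i ∈ Finset.range (Fintype.card W / 2 + 1),
    Polynomial.C ((-1 : ℝ) ^ i * (numMatchings G i : ℝ)) *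
      Polynomial.X ^ (Fintype.card W - 2 * i)

/-- The `k`-th largest real root of `p`, roots being counted with multiplicity, for `k ≥ 1` (and by
convention `0` if `p` has fewer than `k` real roots; a matching polynomial of a graph on `n`
vertices has `n` real roots). -/
noncomputable def kthLargestRoot (p : Polynomial ℝ) (k : ℕ) : ℝ :=
  (p.roots.sort (· ≥ ·)).getD (k - 1) 0

/-! A choice of signs on the incidences of $H$ determines a 2-lift. With $N$ the signed incidence
matrix, the new eigenvalues of the lift are those of $NN^T-dI$ (`spec_lift`), and the signed
adjacency matrix of $B_H$ has blocks $0,N,N^T,0$, so its nonzero eigenvalues are plus and minus the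
square roots of those of $NN^T$. Since $(\sqrt{d-1}-\sqrt{r-1})^2-d=r-2-2\sqrt{(d-1)(r-1)}$, it is
enough to find a signing of $B_H$ with at least $\tau_H$ eigenvalues $\ge
b=|\sqrt{d-1}-\sqrt{r-1}|$; the other $|V|-\tau_H$ eigenvalues of $NN^T$ are zeros forced by its
rank and give the obvious $-d$.

The average of the characteristic polynomials over all signings is the matching polynomial
(`sum_charpoly_signedAdj`), which has $\tau_H$ roots $\ge b$ by hypothesis when $b>0$. The method of
interlacing families passes from the average to one signing (`exists_choice_rootsGE_le`). A signing
is a fixed diagonal matrix minus one rank-one matrix $aa^T$ per edge, with two options for $a$.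
Fixing the edges one at a time, the two partial sums have a common interlacer, so one of them has at
least as many roots $\ge b$ as their sum.

Real-rootedness and interlacing both come from the upper half-plane: determinants of matrices with
positive definite imaginary part are affine in a rank-one perturbation and do not vanish
(`PosIm.detSum_ne_zero`), and root counts are read off from the change of argument along a vertical
line (`rootsGE_interlace`). -/

open Polynomial Filter Topology

/-! ### Root counts and interlacing of real-rooted polynomials -/

namespace RootCount

/-- The number of roots `≥ c` of a real polynomial, counted with multiplicity. -/
noncomputable def rootsGE (p : ℝ[X]) (c : ℝ) : ℕ := p.roots.countP (c ≤ ·)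

/-- The total argument swept by the linear factors along the vertical line through `c`. -/
noncomputable def arctanSum (s : Multiset ℝ) (c u : ℝ) : ℝ :=
  (s.map fun x => Real.arctan ((c - x) * u)).sum

theorem continuous_arctanSum (s : Multiset ℝ) (c : ℝ) : Continuous (arctanSum s c) := by
  unfold arctanSum
  refine continuous_multiset_sum _ fun x _ => ?_
  fun_prop

theorem arctanSum_zero_right (s : Multiset ℝ) (c : ℝ) : arctanSum s c 0 = 0 := by
  simp [arctanSum]

/-- Each element below `c` contributes π/2 in the limit and each one above contributes -π/2, so the
total angle encodes the count. -/
theorem tendsto_arctanSum (s : Multiset ℝ) (c : ℝ) (hc : c ∉ s) :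
    Tendsto (arctanSum s c) atTop
      (𝓝 (Real.pi / 2 * (s.card - 2 * (s.countP (c ≤ ·) : ℝ)))) := by
  induction s using Multiset.induction_on with
  | empty =>
    have : arctanSum 0 c = fun _ => 0 := by funext u; simp [arctanSum]
    simp [this]
  | cons x s ih =>
    rw [Multiset.mem_cons, not_or] at hc
    have ih := ih hc.2
    have hx : arctanSum (x ::ₘ s) c = fun u => Real.arctan ((c - x) * u) + arctanSum s c u := by
      funext u; simp [arctanSum]
    rw [hx]
    rcases lt_or_gt_of_ne hc.1 with h | h
    · have h1 : Tendsto (fun u : ℝ => Real.arctan ((c - x) * u)) atTop (𝓝 (-(Real.pi / 2))) :=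
        (Real.tendsto_arctan_atBot.mono_right nhdsWithin_le_nhds).comp
          (tendsto_id.const_mul_atTop_of_neg (sub_neg.2 h))
      convert h1.add ih using 2
      rw [Multiset.countP_cons_of_pos _ h.le]
      push_cast [Multiset.card_cons]
      ring
    · have h1 : Tendsto (fun u : ℝ => Real.arctan ((c - x) * u)) atTop (𝓝 (Real.pi / 2)) :=
        (Real.tendsto_arctan_atTop.mono_right nhdsWithin_le_nhds).comp
          (tendsto_id.const_mul_atTop (sub_pos.2 h))
      convert h1.add ih using 2
      rw [Multiset.countP_cons_of_neg _ (not_le.2 h)]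
      push_cast [Multiset.card_cons]
      ring

theorem one_sub_I_mul_eq (t : ℝ) :
    1 - Complex.I * t =
      (Real.sqrt (1 + t ^ 2) : ℂ) * Complex.exp (-(Real.arctan t : ℂ) * Complex.I) := by
  have hpos : 0 < Real.sqrt (1 + t ^ 2) := Real.sqrt_pos.2 (by positivity)
  rw [Complex.exp_mul_I, ← Complex.ofReal_neg, ← Complex.ofReal_cos, ← Complex.ofReal_sin,
    Real.cos_neg, Real.sin_neg, Real.cos_arctan, Real.sin_arctan]
  apply Complex.ext
  · simp
    field_simp
  · simp
    field_simp

/-- Polar form of a product of linear factors at the point `c + i / u`. -/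
theorem prod_sub_eq_exp (s : Multiset ℝ) (c u : ℝ) (hu : 0 < u) :
    ∃ R : ℝ, 0 < R ∧ (s.map fun x : ℝ => ((c : ℂ) + Complex.I / u - x)).prod =
      R * Complex.I ^ s.card * Complex.exp (-(arctanSum s c u : ℂ) * Complex.I) := by
  induction s using Multiset.induction_on with
  | empty => exact ⟨1, one_pos, by simp [arctanSum]⟩
  | cons x s ih =>
    obtain ⟨R, hR, h⟩ := ih
    refine ⟨R * (Real.sqrt (1 + ((c - x) * u) ^ 2) / u), ?_, ?_⟩
    · have : 0 < Real.sqrt (1 + ((c - x) * u) ^ 2) := Real.sqrt_pos.2 (by positivity)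
      positivity
    · have hx : arctanSum (x ::ₘ s) c u = Real.arctan ((c - x) * u) + arctanSum s c u := by
        simp [arctanSum]
      have hu' : (u : ℂ) ≠ 0 := by exact_mod_cast hu.ne'
      have key : (c : ℂ) + Complex.I / u - x =
          Complex.I / u * (1 - Complex.I * ((c - x) * u : ℝ)) := by
        field_simp
        push_cast
        ring_nf
        simp
        ring
      rw [Multiset.map_cons, Multiset.prod_cons, h, hx, key, one_sub_I_mul_eq,
        Multiset.card_cons, pow_succ Complex.I]
      generalize (c - x) * u = t
      rw [Complex.ofReal_add, show (-((Real.arctan t : ℂ) + (arctanSum s c u : ℂ)) * Complex.I) =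
        -(Real.arctan t : ℂ) * Complex.I + -(arctanSum s c u : ℂ) * Complex.I by ring,
        Complex.exp_add]
      push_cast
      ring

theorem aeval_eq_exp {p : ℝ[X]} (hp : p.Splits) (hl : 0 < p.leadingCoeff) (c u : ℝ)
    (hu : 0 < u) :
    ∃ R : ℝ, 0 < R ∧ aeval ((c : ℂ) + Complex.I / u) p =
      R * Complex.I ^ p.natDegree * Complex.exp (-(arctanSum p.roots c u : ℂ) * Complex.I) := by
  obtain ⟨R, hR, h⟩ := prod_sub_eq_exp p.roots c u hu
  refine ⟨p.leadingCoeff * R, by positivity, ?_⟩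
  conv_lhs => rw [hp.eq_prod_roots]
  rw [map_mul, aeval_C, map_multiset_prod, Multiset.map_map]
  simp only [Function.comp_def, map_sub, aeval_X, aeval_C, Complex.coe_algebraMap]
  rw [h, hp.natDegree_eq_card_roots]
  push_cast
  ring

/-- If a continuous function vanishes at `0` and its sine is nonpositive on `[0, ∞)`, then it takes
values in `[-π, 0]`. -/
theorem mem_Icc_of_sin_nonpos {ψ : ℝ → ℝ} (hψ : Continuous ψ) (h0 : ψ 0 = 0)
    (hs : ∀ u, 0 < u → Real.sin (ψ u) ≤ 0) {u : ℝ} (hu : 0 < u) :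
    ψ u ∈ Set.Icc (-Real.pi) 0 := by
  have hpi := Real.pi_pos
  have key : ∀ y, y ∈ Set.uIcc (ψ 0) (ψ u) → y ≠ 0 → Real.sin y ≤ 0 := by
    intro y hy hy0
    obtain ⟨t, ht, rfl⟩ := intermediate_value_uIcc hψ.continuousOn hy
    rw [Set.uIcc_of_le hu.le] at ht
    rcases ht.1.eq_or_lt with h | h
    · exact absurd (h ▸ h0) hy0
    · exact hs t h
  rw [h0] at key
  constructor
  · by_contra! h
    -- A value below -π would force an intermediate value in [-3π/2, -π), where the sine is
    -- positive. The truncation at -3π/2 keeps within one half-period; the upper bound uses π/2 in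
    -- the same way.
    have hlt := key (max (ψ u) (-(3 * Real.pi / 2)))
      ⟨by simp, by simp [h.le.trans (neg_nonpos.2 hpi.le)]; positivity⟩
      (ne_of_lt (max_lt (by linarith) (by linarith)))
    have h1 := Real.sin_neg_of_neg_of_neg_pi_lt
      (x := max (ψ u) (-(3 * Real.pi / 2)) + Real.pi)
      (by have : max (ψ u) (-(3 * Real.pi / 2)) < -Real.pi := max_lt h (by linarith)
          linarith)
      (by have := le_max_right (ψ u) (-(3 * Real.pi / 2)); linarith)
    rw [Real.sin_add_pi] at h1
    linarith
  · by_contra! h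
    have hlt := key (min (ψ u) (Real.pi / 2))
      ⟨by simp [h.le]; positivity, by simp⟩ (ne_of_gt (lt_min h (by linarith)))
    have := Real.sin_pos_of_pos_of_lt_pi (lt_min h (half_pos hpi))
      ((min_le_right _ _).trans_lt (by linarith))
    linarith

/-- Interlacing of two real-rooted polynomials whose quotient maps the upper half-plane to the
closed lower half-plane. -/
theorem rootsGE_interlace {p q : ℝ[X]} (hp : p.Splits) (hq : q.Splits)
    (hlp : 0 < p.leadingCoeff) (hlq : 0 < q.leadingCoeff) (hdeg : p.natDegree = q.natDegree)
    (him : ∀ z : ℂ, 0 < z.im → (aeval z q * star (aeval z p)).im ≤ 0)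
    {c : ℝ} (hcp : c ∉ p.roots) (hcq : c ∉ q.roots) :
    rootsGE q c ≤ rootsGE p c ∧ rootsGE p c ≤ rootsGE q c + 1 := by
  set ψ : ℝ → ℝ := fun u => arctanSum p.roots c u - arctanSum q.roots c u with hψdef
  have hψ : Continuous ψ := (continuous_arctanSum _ _).sub (continuous_arctanSum _ _)
  have h0 : ψ 0 = 0 := by simp [hψdef, arctanSum_zero_right]
  have hs : ∀ u, 0 < u → Real.sin (ψ u) ≤ 0 := by
    intro u hu
    obtain ⟨R, hR, h⟩ := aeval_eq_exp hp hlp c u hu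
    obtain ⟨R', hR', h'⟩ := aeval_eq_exp hq hlq c u hu
    have hz := him ((c : ℂ) + Complex.I / u) (by
      have : ((c : ℂ) + Complex.I / u).im = u⁻¹ := by
        simp [Complex.div_im]
      rw [this]; positivity)
    have e : aeval ((c : ℂ) + Complex.I / u) q * star (aeval ((c : ℂ) + Complex.I / u) p) =
        ((R' * R : ℝ) : ℂ) * Complex.exp ((ψ u : ℂ) * Complex.I) := by
      rw [h, h', ← hdeg]
      simp only [star_mul', Complex.star_def, map_pow, Complex.conj_ofReal, Complex.conj_I,
        ← Complex.exp_conj, map_mul, map_neg]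
      rw [show (ψ u : ℂ) * Complex.I = -(arctanSum q.roots c u : ℂ) * Complex.I +
        -(arctanSum p.roots c u : ℂ) * -Complex.I by simp [hψdef]; ring, Complex.exp_add]
      -- Equal degrees make the powers of $i$ cancel, so `ψ u` is exactly an argument of the
      -- product.
      have hI : Complex.I ^ p.natDegree * (-Complex.I) ^ p.natDegree = 1 := by
        rw [← mul_pow]; simp
      push_cast
      linear_combination (R' * R * Complex.exp (-(arctanSum q.roots c u : ℂ) * Complex.I) *
        Complex.exp (-(arctanSum p.roots c u : ℂ) * -Complex.I)) * hI
    rw [e, Complex.im_ofReal_mul, Complex.exp_ofReal_mul_I_im] at hz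
    exact nonpos_of_mul_nonpos_right hz (by positivity)
  -- As `u → ∞` the point descends to `c`, and `ψ` tends to π times the difference of the two root
  -- counts, which must lie in [-π, 0].
  have hlim := (tendsto_arctanSum p.roots c hcp).sub (tendsto_arctanSum q.roots c hcq)
  have hmem := isClosed_Icc.mem_of_tendsto hlim
    ((eventually_gt_atTop (0 : ℝ)).mono fun u hu => mem_Icc_of_sin_nonpos hψ h0 hs hu)
  rw [← hp.natDegree_eq_card_roots, ← hq.natDegree_eq_card_roots, hdeg] at hmem
  have e : Real.pi / 2 * ((q.natDegree : ℝ) - 2 * (p.roots.countP (c ≤ ·) : ℝ)) -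
      Real.pi / 2 * ((q.natDegree : ℝ) - 2 * (q.roots.countP (c ≤ ·) : ℝ)) =
      Real.pi * ((rootsGE q c : ℝ) - rootsGE p c) := by
    unfold rootsGE; ring
  rw [e] at hmem
  have h1 : (rootsGE q c : ℝ) - rootsGE p c ≤ 0 :=
    nonpos_of_mul_nonpos_right hmem.2 Real.pi_pos
  have h2 : (rootsGE p c : ℝ) ≤ rootsGE q c + 1 := by
    nlinarith [hmem.1, Real.pi_pos]
  constructor
  · exact_mod_cast sub_nonpos.1 h1
  · exact_mod_cast h2

theorem sign_prod_sub (s : Multiset ℝ) (c : ℝ) (hc : c ∉ s) :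
    0 < (-1 : ℝ) ^ s.countP (c ≤ ·) * (s.map fun x => c - x).prod := by
  induction s using Multiset.induction_on with
  | empty => simp
  | cons x s ih =>
    rw [Multiset.mem_cons, not_or] at hc
    have ih := ih hc.2
    rw [Multiset.map_cons, Multiset.prod_cons]
    rcases lt_or_gt_of_ne hc.1 with h | h
    · rw [Multiset.countP_cons_of_pos _ h.le, pow_succ]
      nlinarith
    · rw [Multiset.countP_cons_of_neg _ (not_le.2 h)]
      nlinarith

theorem sign_eval {p : ℝ[X]} (hp : p.Splits) (hl : 0 < p.leadingCoeff) {c : ℝ}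
    (hc : c ∉ p.roots) : 0 < (-1 : ℝ) ^ rootsGE p c * p.eval c := by
  rw [hp.eval_eq_prod_roots, mul_left_comm]
  exact mul_pos hl (sign_prod_sub _ _ hc)

/-- Moving `c` slightly to the left avoids the finitely many roots without crossing any, which
reduces to the generic case. -/
theorem exists_rootsGE_const (s : Finset ℝ[X]) (c : ℝ) :
    ∃ c' : ℝ, ∀ p ∈ s, rootsGE p c' = rootsGE p c ∧ c' ∉ p.roots := by
  classical
  have hfin : (⋃ p ∈ s, {x | x ∈ p.roots}).Finite :=
    s.finite_toSet.biUnion fun p _ => (p.roots.toFinset.finite_toSet.subset (by intro x; simp))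
  have hev : ∀ᶠ x in 𝓝[<] c, ∀ y ∈ ⋃ p ∈ s, {x | x ∈ p.roots}, ¬ (x ≤ y ∧ y < c) := by
    rw [hfin.eventually_all]
    intro y _
    rcases lt_or_ge y c with h | h
    · filter_upwards [Ioo_mem_nhdsLT h] with x hx hxy
      exact absurd hx.1 (not_lt.2 hxy.1)
    · exact Eventually.of_forall fun x hx => absurd hx.2 (not_lt.2 h)
  obtain ⟨x, hx, hxc⟩ := (hev.and self_mem_nhdsWithin).exists
  refine ⟨x, fun p hp => ⟨?_, fun h => ?_⟩⟩
  · unfold rootsGE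
    refine Multiset.countP_congr rfl fun y hy => ?_
    have := hx y (by simp only [Set.mem_iUnion]; exact ⟨p, hp, hy⟩)
    refine propext ⟨fun h => ?_, fun h => (le_of_lt hxc).trans h⟩
    by_contra! h'
    exact this ⟨h, h'⟩
  · exact hx x (by simp only [Set.mem_iUnion]; exact ⟨p, hp, h⟩) ⟨le_rfl, hxc⟩

/-- Two real-rooted polynomials with a common interlacer: the sum has at most as many roots `≥ c`
as one of the summands. -/
theorem rootsGE_add_le {F f g : ℝ[X]} (hF : F.Splits) (hf : f.Splits) (hg : g.Splits)
    (hfg : (f + g).Splits) (hlF : 0 < F.leadingCoeff) (hlf : 0 < f.leadingCoeff)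
    (hlg : 0 < g.leadingCoeff) (hlfg : 0 < (f + g).leadingCoeff)
    (hdf : F.natDegree = f.natDegree) (hdg : F.natDegree = g.natDegree)
    (hdfg : F.natDegree = (f + g).natDegree)
    (hif : ∀ z : ℂ, 0 < z.im → (aeval z f * star (aeval z F)).im ≤ 0)
    (hig : ∀ z : ℂ, 0 < z.im → (aeval z g * star (aeval z F)).im ≤ 0) (c : ℝ) :
    rootsGE (f + g) c ≤ rootsGE f c ∨ rootsGE (f + g) c ≤ rootsGE g c := by
  classical
  obtain ⟨x, hx⟩ := exists_rootsGE_const {F, f, g, f + g} c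
  obtain ⟨-, hxF⟩ := hx F (by simp)
  obtain ⟨ef, hxf⟩ := hx f (by simp)
  obtain ⟨eg, hxg⟩ := hx g (by simp)
  obtain ⟨efg, hxfg⟩ := hx (f + g) (by simp)
  rw [← ef, ← eg, ← efg]
  have h1 := rootsGE_interlace hF hf hlF hlf hdf hif hxF hxf
  have h2 := rootsGE_interlace hF hg hlF hlg hdg hig hxF hxg
  have h3 := rootsGE_interlace hF hfg hlF hlfg hdfg (fun z hz => by
    rw [map_add, add_mul, Complex.add_im]; linarith [hif z hz, hig z hz]) hxF hxfg
  -- All three counts lie within one below that of `F`. If the sum exceeded both summands, `f` and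
  -- `g` would have equal counts, hence the same sign at `x`, while the count of `f + g` would have
  -- the other parity and so the opposite sign.
  by_contra! hcon
  have e1 : rootsGE f x = rootsGE g x := by omega
  have e2 : rootsGE (f + g) x = rootsGE g x + 1 := by omega
  have s1 := sign_eval hf hlf hxf
  have s2 := sign_eval hg hlg hxg
  have s3 := sign_eval hfg hlfg hxfg
  rw [e1] at s1
  rw [e2, pow_succ, eval_add] at s3
  nlinarith

/-- A real polynomial without zeros in the upper half-plane is real-rooted. -/
theorem splits_of_aeval_ne_zero {p : ℝ[X]} (h : ∀ z : ℂ, 0 < z.im → aeval z p ≠ 0) :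
    p.Splits := by
  refine Splits.of_splits_map (algebraMap ℝ ℂ) (IsAlgClosed.splits _) fun z hz => ?_
  have hz0 : aeval z p = 0 := by
    rw [← eval_map_algebraMap]
    exact (mem_roots'.1 hz).2
  have him : z.im = 0 := by
    rcases lt_trichotomy z.im 0 with hlt | heq | hgt
    · refine absurd ?_ (h (star z) (by simpa using hlt))
      have := congrArg star hz0
      rw [star_zero] at this
      rw [← this]
      exact (aeval_conj p z)
    · exact heq
    · exact absurd hz0 (h z hgt)
  exact ⟨z.re, Complex.ext (by simp) (by simp [him])⟩

end RootCount

/-! ### Sums over choices of rank-one perturbations -/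

/-- The sum of the values of `g` at all translates of `x` by a choice of `A e` or `B e` for each
`e ∈ S`; the choice is recorded by the set of those `e` for which `A e` is taken. -/
def powersetSum {ι M R : Type*} [DecidableEq ι] [AddCommMonoid M] [AddCommMonoid R]
    (A B : ι → M) (S : Finset ι) (g : M → R) (x : M) : R :=
  ∑ T ∈ S.powerset, g (x + ∑ e ∈ S, if e ∈ T then A e else B e)

theorem powersetSum_insert {ι M R : Type*} [DecidableEq ι] [AddCommMonoid M] [AddCommMonoid R]
    (A B : ι → M) {e : ι} {S : Finset ι} (he : e ∉ S) (g : M → R) (x : M) :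
    powersetSum A B (insert e S) g x =
      powersetSum A B S g (x + B e) + powersetSum A B S g (x + A e) := by
  unfold powersetSum
  rw [Finset.sum_powerset_insert he]
  congr 1
  · refine Finset.sum_congr rfl fun T hT => ?_
    rw [Finset.sum_insert he, if_neg fun h => he (Finset.mem_powerset.1 hT h), add_assoc]
  · refine Finset.sum_congr rfl fun T _ => ?_
    rw [Finset.sum_insert he, if_pos (Finset.mem_insert_self _ _), add_assoc]
    congr 3
    refine Finset.sum_congr rfl fun f hf => ?_
    simp [show f ≠ e from fun h => he (h ▸ hf)]

namespace Matrix

variable {W : Type*} [Fintype W]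

/-- The matrices whose skew-Hermitian part is `i` times a positive definite matrix. -/
def PosIm (Z : Matrix W W ℂ) : Prop :=
  ∀ v : W → ℂ, v ≠ 0 → 0 < (star v ⬝ᵥ Z *ᵥ v).im

/-- The matrix `a aᵀ` of a real vector, as a complex matrix. -/
def rankOne (a : W → ℝ) : Matrix W W ℂ :=
  vecMulVec (fun i => (a i : ℂ)) (fun i => (a i : ℂ))

theorem star_dotProduct_rankOne (a : W → ℝ) (v : W → ℂ) :
    star v ⬝ᵥ rankOne a *ᵥ v = (Complex.normSq ((fun i => (a i : ℂ)) ⬝ᵥ v) : ℂ) := by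
  rw [rankOne, vecMulVec_mulVec, Complex.normSq_eq_conj_mul_self]
  simp only [dotProduct_smul, op_smul_eq_smul, smul_eq_mul]
  rw [mul_comm]
  congr 1
  simp [dotProduct, mul_comm]

theorem PosIm.add_smul_rankOne {Z : Matrix W W ℂ} (hZ : PosIm Z) (a : W → ℝ) {t : ℂ}
    (ht : 0 ≤ t.im) : PosIm (Z + t • rankOne a) := by
  intro v hv
  rw [add_mulVec, dotProduct_add, smul_mulVec, dotProduct_smul, star_dotProduct_rankOne,
    Complex.add_im, smul_eq_mul, Complex.im_mul_ofReal]
  have := hZ v hv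
  have := mul_nonneg ht (Complex.normSq_nonneg ((fun i => (a i : ℂ)) ⬝ᵥ v))
  linarith

theorem PosIm.add_rankOne {Z : Matrix W W ℂ} (hZ : PosIm Z) (a : W → ℝ) :
    PosIm (Z + rankOne a) := by
  simpa using hZ.add_smul_rankOne a (t := 1) (by simp)

theorem PosIm.add_sum {ι : Type*} {Z : Matrix W W ℂ} (hZ : PosIm Z) (S : Finset ι)
    (a : ι → W → ℝ) : PosIm (Z + ∑ e ∈ S, rankOne (a e)) := by
  classical
  induction S using Finset.induction_on with
  | empty => simpa using hZ
  | insert e S he ih =>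
    rw [Finset.sum_insert he, add_comm (rankOne (a e)), ← add_assoc]
    exact ih.add_rankOne _

variable [DecidableEq W]

theorem PosIm.det_ne_zero {Z : Matrix W W ℂ} (hZ : PosIm Z) : Z.det ≠ 0 := by
  intro h
  obtain ⟨v, hv, h0⟩ := exists_mulVec_eq_zero_iff.2 h
  have := hZ v hv
  simp [h0] at this

/-- The matrix determinant lemma, applicable because `Z` is invertible. -/
theorem PosIm.exists_det_add_smul {Z : Matrix W W ℂ} (hZ : PosIm Z) (a : W → ℝ) :
    ∃ D : ℂ, ∀ t : ℂ, (Z + t • rankOne a).det = Z.det + t * D := by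
  have hu : IsUnit Z.det := isUnit_iff_ne_zero.2 hZ.det_ne_zero
  refine ⟨Z.det * (replicateRow Unit (fun i => (a i : ℂ)) * Z⁻¹ *
    replicateCol Unit (fun i => (a i : ℂ))).det, fun t => ?_⟩
  have := det_add_replicateCol_mul_replicateRow (ι := Unit) hu (t • fun i => (a i : ℂ))
    (fun i => (a i : ℂ))
  rw [rankOne, ← smul_vecMulVec, vecMulVec_eq Unit, this, replicateCol_smul]
  rw [Matrix.mul_smul]
  simp only [det_unique, smul_apply, smul_eq_mul, add_apply, one_apply_eq]
  ring

variable {ι : Type*} [DecidableEq ι]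

/-- The sum of the determinants over all choices of rank one summands. -/
noncomputable def detSum (a b : ι → W → ℝ) (S : Finset ι) (Z : Matrix W W ℂ) : ℂ :=
  powersetSum (fun e => rankOne (a e)) (fun e => rankOne (b e)) S det Z

theorem PosIm.exists_detSum_add_smul (a b : ι → W → ℝ) (S : Finset ι) {Z : Matrix W W ℂ}
    (hZ : PosIm Z) (c : W → ℝ) :
    ∃ D : ℂ, ∀ t : ℂ, detSum a b S (Z + t • rankOne c) = detSum a b S Z + t * D := by
  have h : ∀ T : Finset ι, ∃ D : ℂ, ∀ t : ℂ,
      (Z + t • rankOne c + ∑ e ∈ S, if e ∈ T then rankOne (a e) else rankOne (b e)).det =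
      (Z + ∑ e ∈ S, if e ∈ T then rankOne (a e) else rankOne (b e)).det + t * D := by
    intro T
    have hT : PosIm (Z + ∑ e ∈ S, if e ∈ T then rankOne (a e) else rankOne (b e)) := by
      simpa only [apply_ite rankOne] using hZ.add_sum S fun e => if e ∈ T then a e else b e
    obtain ⟨D, hD⟩ := hT.exists_det_add_smul c
    exact ⟨D, fun t => by rw [add_right_comm, hD]⟩
  choose D hD using h
  refine ⟨∑ T ∈ S.powerset, D T, fun t => ?_⟩
  simp only [detSum, powersetSum, hD, Finset.sum_add_distrib, Finset.mul_sum]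

/-- If `D ≠ 0`, the zero `-F / D` must lie in the open lower half-plane, and its imaginary part has
the sign of that of `D * star F`. -/
theorem slope_of_ne_zero {F D : ℂ} (h : ∀ t : ℂ, 0 ≤ t.im → F + t * D ≠ 0) :
    D = 0 ∨ (D * star F).im < 0 := by
  by_contra! hcon
  obtain ⟨hD, him⟩ := hcon
  refine h (-F / D) ?_ (by field_simp; ring)
  have : -F / D = ((Complex.normSq D)⁻¹ : ℝ) * (-star (D * star F)) := by
    rw [div_eq_mul_inv, Complex.inv_def]
    simp
    ring
  rw [this, Complex.im_ofReal_mul]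
  refine mul_nonneg (inv_nonneg.2 (Complex.normSq_nonneg D)) ?_
  rw [Complex.star_def, Complex.neg_im, Complex.conj_im, neg_neg]
  exact him

theorem PosIm.detSum_ne_zero (a b : ι → W → ℝ) (S : Finset ι) {Z : Matrix W W ℂ}
    (hZ : PosIm Z) : detSum a b S Z ≠ 0 := by
  induction S using Finset.induction_on generalizing Z with
  | empty => simpa [detSum, powersetSum] using hZ.det_ne_zero
  | insert e S he ih =>
    rw [detSum, powersetSum_insert _ _ he]
    obtain ⟨D, hD⟩ := hZ.exists_detSum_add_smul a b S (a e)
    obtain ⟨D', hD'⟩ := hZ.exists_detSum_add_smul a b S (b e)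
    have h1 := slope_of_ne_zero (F := detSum a b S Z) (D := D) fun t ht => by
      rw [← hD]; exact ih (hZ.add_smul_rankOne _ ht)
    have h2 := slope_of_ne_zero (F := detSum a b S Z) (D := D') fun t ht => by
      rw [← hD']; exact ih (hZ.add_smul_rankOne _ ht)
    have e1 := hD 1
    have e2 := hD' 1
    rw [one_smul, one_mul] at e1 e2
    change detSum a b S _ + detSum a b S _ ≠ 0
    rw [e1, e2]
    -- The sum is `2F + D + D'`. Multiplying by `star F` makes the `F` term real, and the slopes
    -- contribute negative imaginary part unless both vanish, in which case `2F ≠ 0` remains.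
    intro h0
    have hF := ih hZ
    have h0' := congrArg (fun w => (w * star (detSum a b S Z)).im) h0
    have hFF : (detSum a b S Z * star (detSum a b S Z)).im = 0 := by
      rw [Complex.star_def, Complex.mul_conj, Complex.ofReal_im]
    simp only [add_mul, Complex.add_im, hFF, zero_mul, Complex.zero_im] at h0'
    rcases h1 with h1 | h1 <;> rcases h2 with h2 | h2
    · rw [h1, h2] at h0
      apply hF
      linear_combination h0 / 2
    · simp [h1] at h0'; simp at h2; linarith
    · simp [h2] at h0'; simp at h1; linarith
    · linarith

theorem PosIm.detSum_add_rankOne_mul_star (a b : ι → W → ℝ) (S : Finset ι) {Z : Matrix W W ℂ}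
    (hZ : PosIm Z) (c : W → ℝ) :
    (detSum a b S (Z + rankOne c) * star (detSum a b S Z)).im ≤ 0 := by
  obtain ⟨D, hD⟩ := hZ.exists_detSum_add_smul a b S c
  have h1 := slope_of_ne_zero (F := detSum a b S Z) (D := D) fun t ht => by
    rw [← hD]; exact (hZ.add_smul_rankOne _ ht).detSum_ne_zero a b S
  have e1 := hD 1
  rw [one_smul, one_mul] at e1
  have hFF : (detSum a b S Z * star (detSum a b S Z)).im = 0 := by
    rw [Complex.star_def, Complex.mul_conj, Complex.ofReal_im]
  rw [e1, add_mul, Complex.add_im, hFF, zero_add]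
  rcases h1 with h1 | h1
  · simp [h1]
  · exact h1.le

theorem posIm_smul_one_sub {C : Matrix W W ℝ} (hC : C.IsSymm) {z : ℂ} (hz : 0 < z.im) :
    PosIm (z • (1 : Matrix W W ℂ) - C.map Complex.ofReal) := by
  intro v hv
  have hH : (C.map Complex.ofReal).IsHermitian := by
    ext i j
    simp [conjTranspose_apply, hC.apply]
  have h1 : (star v ⬝ᵥ C.map Complex.ofReal *ᵥ v).im = 0 := hH.im_star_dotProduct_mulVec_self v
  rw [sub_mulVec, dotProduct_sub, smul_mulVec, one_mulVec, dotProduct_smul, Complex.sub_im, h1,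
    sub_zero, smul_eq_mul]
  have h2 : star v ⬝ᵥ v = ((∑ i, Complex.normSq (v i) : ℝ) : ℂ) := by
    simp [dotProduct, Complex.normSq_eq_conj_mul_self]
  rw [h2, Complex.im_mul_ofReal]
  obtain ⟨i, hi⟩ := Function.ne_iff.1 hv
  exact mul_pos hz (Finset.sum_pos' (fun j _ => Complex.normSq_nonneg _)
    ⟨i, Finset.mem_univ _, Complex.normSq_pos.2 hi⟩)

/-- The sum of the characteristic polynomials of `C` minus all choices of rank one matrices. -/
noncomputable def charpolySum (a b : ι → W → ℝ) (S : Finset ι) (C : Matrix W W ℝ) : ℝ[X] :=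
  powersetSum (fun e => -vecMulVec (a e) (a e)) (fun e => -vecMulVec (b e) (b e)) S charpoly C

theorem aeval_charpoly_eq_det (M : Matrix W W ℝ) (z : ℂ) :
    aeval z M.charpoly = (z • (1 : Matrix W W ℂ) - M.map Complex.ofReal).det := by
  rw [← eval_map_algebraMap, ← charpoly_map, eval_charpoly, scalar_apply, ← smul_one_eq_diagonal]
  rfl

theorem aeval_charpolySum (a b : ι → W → ℝ) (S : Finset ι) (C : Matrix W W ℝ) (z : ℂ) :
    aeval z (charpolySum a b S C) =
      detSum a b S (z • (1 : Matrix W W ℂ) - C.map Complex.ofReal) := by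
  simp only [charpolySum, detSum, powersetSum, map_sum, aeval_charpoly_eq_det]
  refine Finset.sum_congr rfl fun T _ => ?_
  congr 1
  ext i j
  simp only [sub_apply, add_apply, map_apply, sum_apply, Complex.ofReal_add, Complex.ofReal_sum]
  rw [sub_add_eq_sub_sub, sub_eq_add_neg _ (∑ _ ∈ _, _), ← Finset.sum_neg_distrib]
  congr 1
  refine Finset.sum_congr rfl fun e _ => ?_
  split_ifs <;> simp [rankOne, vecMulVec_apply]

theorem charpolySum_natDegree_le (a b : ι → W → ℝ) (S : Finset ι) (C : Matrix W W ℝ) :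
    (charpolySum a b S C).natDegree ≤ Fintype.card W :=
  natDegree_sum_le_of_forall_le _ _ fun _ _ => (charpoly_natDegree_eq_dim _).le

theorem charpolySum_coeff (a b : ι → W → ℝ) (S : Finset ι) (C : Matrix W W ℝ) :
    (charpolySum a b S C).coeff (Fintype.card W) = 2 ^ S.card := by
  have h : ∀ M : Matrix W W ℝ, M.charpoly.coeff (Fintype.card W) = 1 := fun M => by
    rw [← charpoly_natDegree_eq_dim M]; exact M.charpoly_monic
  simp [charpolySum, powersetSum, h]

theorem charpolySum_natDegree (a b : ι → W → ℝ) (S : Finset ι) (C : Matrix W W ℝ) :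
    (charpolySum a b S C).natDegree = Fintype.card W :=
  natDegree_eq_of_le_of_coeff_ne_zero (charpolySum_natDegree_le a b S C)
    (by rw [charpolySum_coeff]; positivity)

theorem charpolySum_leadingCoeff_pos (a b : ι → W → ℝ) (S : Finset ι) (C : Matrix W W ℝ) :
    0 < (charpolySum a b S C).leadingCoeff := by
  rw [leadingCoeff, charpolySum_natDegree, charpolySum_coeff]
  positivity

theorem charpolySum_splits (a b : ι → W → ℝ) (S : Finset ι) {C : Matrix W W ℝ}
    (hC : C.IsSymm) : (charpolySum a b S C).Splits :=
  RootCount.splits_of_aeval_ne_zero fun z hz => by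
    rw [aeval_charpolySum]
    exact (posIm_smul_one_sub hC hz).detSum_ne_zero a b S

theorem isSymm_vecMulVec_self {n : Type*} (a : n → ℝ) : (vecMulVec a a).IsSymm := by
  ext i j; simp [vecMulVec_apply, mul_comm]

theorem aeval_charpolySum_mul_star (a b : ι → W → ℝ) (S : Finset ι) {C : Matrix W W ℝ}
    (hC : C.IsSymm) (c : W → ℝ) {z : ℂ} (hz : 0 < z.im) :
    (aeval z (charpolySum a b S (C + -vecMulVec c c)) *
      star (aeval z (charpolySum a b S C))).im ≤ 0 := by
  rw [aeval_charpolySum, aeval_charpolySum]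
  convert (posIm_smul_one_sub hC hz).detSum_add_rankOne_mul_star a b S c using 5
  ext i j
  simp [rankOne, vecMulVec_apply]
  ring

/-- Among all choices of rank one summands there is one for which the characteristic polynomial has
at least as many roots `≥ c` as the sum of all the characteristic polynomials. -/
theorem exists_choice_rootsGE_le (a b : ι → W → ℝ) (S : Finset ι) {C : Matrix W W ℝ}
    (hC : C.IsSymm) (c : ℝ) :
    ∃ T ⊆ S, RootCount.rootsGE (charpolySum a b S C) c ≤ RootCount.rootsGE
      (charpoly (C + ∑ e ∈ S, if e ∈ T then -vecMulVec (a e) (a e)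
        else -vecMulVec (b e) (b e))) c := by
  induction S using Finset.induction_on generalizing C with
  | empty => exact ⟨∅, le_rfl, by simp [charpolySum, powersetSum]⟩
  | insert e S he ih =>
    have hCa : (C + -vecMulVec (a e) (a e)).IsSymm := hC.add (isSymm_vecMulVec_self _).neg
    have hCb : (C + -vecMulVec (b e) (b e)).IsSymm := hC.add (isSymm_vecMulVec_self _).neg
    have heq : charpolySum a b (insert e S) C =
        charpolySum a b S (C + -vecMulVec (b e) (b e)) +
        charpolySum a b S (C + -vecMulVec (a e) (a e)) :=
      powersetSum_insert _ _ he _ _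
    -- The common interlacer is the sum over `S` with no rank-one matrix subtracted for `e`.
    have hor := RootCount.rootsGE_add_le (charpolySum_splits a b S hC)
      (charpolySum_splits a b S hCb) (charpolySum_splits a b S hCa)
      (heq ▸ charpolySum_splits a b (insert e S) hC)
      (charpolySum_leadingCoeff_pos ..) (charpolySum_leadingCoeff_pos ..)
      (charpolySum_leadingCoeff_pos ..) (heq ▸ charpolySum_leadingCoeff_pos ..)
      (by simp only [charpolySum_natDegree]) (by simp only [charpolySum_natDegree])
      (by rw [← heq]; simp only [charpolySum_natDegree])
      (fun z hz => aeval_charpolySum_mul_star a b S hC _ hz)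
      (fun z hz => aeval_charpolySum_mul_star a b S hC _ hz) c
    rw [heq]
    rcases hor with h | h
    · obtain ⟨T, hT, hle⟩ := ih hCb
      refine ⟨T, hT.trans (Finset.subset_insert _ _), h.trans (hle.trans (le_of_eq ?_))⟩
      rw [Finset.sum_insert he, if_neg fun h => he (hT h), add_assoc]
    · obtain ⟨T, hT, hle⟩ := ih hCa
      refine ⟨insert e T, Finset.insert_subset_insert _ hT, h.trans (hle.trans (le_of_eq ?_))⟩
      rw [Finset.sum_insert he, if_pos (Finset.mem_insert_self _ _), add_assoc]
      congr 4
      refine Finset.sum_congr rfl fun f hf => ?_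
      simp [show f ≠ e from fun h => he (h ▸ hf)]

end Matrix

/-! ### Signed adjacency matrices and the matching polynomial -/

namespace SimpleGraph

variable {W : Type u}

open Classical in
/-- The sign `-1` on the edges in `T`, and `1` elsewhere. -/
noncomputable def edgeSign (T : Finset (Sym2 W)) (e : Sym2 W) : ℝ := if e ∈ T then -1 else 1

theorem edgeSign_mul_self (T : Finset (Sym2 W)) (e : Sym2 W) :
    edgeSign T e * edgeSign T e = 1 := by
  unfold edgeSign; split_ifs <;> norm_num

open Classical in
/-- The adjacency matrix of `G`, with the entries of the edges in `T` negated. -/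
noncomputable def signedAdj (G : SimpleGraph W) (T : Finset (Sym2 W)) : Matrix W W ℝ :=
  Matrix.of fun u v => if G.Adj u v then edgeSign T s(u, v) else 0

theorem signedAdj_comm (G : SimpleGraph W) (T : Finset (Sym2 W)) (u v : W) :
    G.signedAdj T u v = G.signedAdj T v u := by
  by_cases h : G.Adj u v
  · simp [signedAdj, h, h.symm, Sym2.eq_swap]
  · simp [signedAdj, h, mt SimpleGraph.Adj.symm h]

/-- The condition on a set of edges in `numMatchings`. -/
def IsEdgeMatching (G : SimpleGraph W) (M : Finset (Sym2 W)) : Prop :=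
  (∀ e ∈ M, e ∈ G.edgeSet) ∧ ∀ e ∈ M, ∀ f ∈ M, e ≠ f → ∀ w : W, ¬ (w ∈ e ∧ w ∈ f)

/-- The permutations that come from matchings of `G`. -/
def IsMatchingPerm (G : SimpleGraph W) (σ : Equiv.Perm W) : Prop :=
  (∀ i, σ (σ i) = i) ∧ ∀ i, σ i ≠ i → G.Adj (σ i) i

theorem edgeSign_symmDiff [DecidableEq W] (T : Finset (Sym2 W)) (e f : Sym2 W) :
    edgeSign (symmDiff T {e}) f = if f = e then -edgeSign T f else edgeSign T f := by
  unfold edgeSign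
  by_cases h : f = e <;> by_cases h' : f ∈ T <;> simp_all [Finset.mem_symmDiff]

theorem mk_eq_mk_of_mem {σ : Equiv.Perm W} (hσ : ∀ i, σ (σ i) = i) {i w : W} (h : w ∈ s(σ i, i)) :
    s(σ i, i) = s(σ w, w) := by
  rcases Sym2.mem_iff.1 h with rfl | rfl
  · rw [hσ, Sym2.eq_swap]
  · rfl

/-- One of the two endpoints of an edge. -/
noncomputable def fstEnd (e : Sym2 W) : W := (Quot.out e).1

/-- The other endpoint of an edge. -/
noncomputable def sndEnd (e : Sym2 W) : W := (Quot.out e).2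

theorem mk_ends (e : Sym2 W) : s(fstEnd e, sndEnd e) = e := Quot.out_eq e

section Perm

variable [Fintype W] [DecidableEq W]

/-- The edges joining the points moved by `σ` to their images. -/
def permEdges (σ : Equiv.Perm W) : Finset (Sym2 W) := σ.support.image fun i => s(σ i, i)

variable {G : SimpleGraph W} {σ τ : Equiv.Perm W}

theorem mem_permEdges_iff (hσ : ∀ i, σ (σ i) = i) {e : Sym2 W} {w : W} (hw : w ∈ e) :
    e ∈ permEdges σ ↔ σ w ≠ w ∧ e = s(σ w, w) := by
  constructor
  · intro h
    obtain ⟨i, hi, rfl⟩ := Finset.mem_image.1 h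
    refine ⟨?_, mk_eq_mk_of_mem hσ hw⟩
    rw [Equiv.Perm.mem_support] at hi
    rcases Sym2.mem_iff.1 hw with rfl | rfl
    · rw [hσ]; exact hi.symm
    · exact hi
  · rintro ⟨h, rfl⟩
    exact Finset.mem_image.2 ⟨w, Equiv.Perm.mem_support.2 h, rfl⟩

theorem IsMatchingPerm.isEdgeMatching (hσ : G.IsMatchingPerm σ) :
    G.IsEdgeMatching (permEdges σ) := by
  constructor
  · intro e he
    obtain ⟨i, hi, rfl⟩ := Finset.mem_image.1 he
    exact hσ.2 i (Equiv.Perm.mem_support.1 hi)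
  · rintro e he f hf hef w ⟨hwe, hwf⟩
    rw [mem_permEdges_iff hσ.1 hwe] at he
    rw [mem_permEdges_iff hσ.1 hwf] at hf
    exact hef (he.2.trans hf.2.symm)

theorem permEdges_injective (hσ : ∀ i, σ (σ i) = i) (hτ : ∀ i, τ (τ i) = i)
    (h : permEdges σ = permEdges τ) : σ = τ := by
  ext i
  by_cases hi : σ i = i
  · by_contra hne
    have h1 : s(τ i, i) ∈ permEdges τ :=
      (mem_permEdges_iff hτ (Sym2.mem_mk_right _ _)).2 ⟨fun h => hne (hi.trans h.symm), rfl⟩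
    rw [← h, mem_permEdges_iff hσ (Sym2.mem_mk_right _ _)] at h1
    exact h1.1 hi
  · have h1 : s(σ i, i) ∈ permEdges σ :=
      (mem_permEdges_iff hσ (Sym2.mem_mk_right _ _)).2 ⟨hi, rfl⟩
    rw [h, mem_permEdges_iff hτ (Sym2.mem_mk_right _ _)] at h1
    exact Sym2.congr_left.1 h1.2

theorem card_support_eq (hσ : ∀ i, σ (σ i) = i) :
    σ.support.card = 2 * (permEdges σ).card := by
  rw [permEdges, Finset.card_eq_sum_card_image (fun i => s(σ i, i)) σ.support,
    Finset.sum_const_nat (m := 2), mul_comm]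
  intro e he
  obtain ⟨i, hi, rfl⟩ := Finset.mem_image.1 he
  have hi' := Equiv.Perm.mem_support.1 hi
  have : (σ.support.filter fun j => s(σ j, j) = s(σ i, i)) = {σ i, i} := by
    ext j
    simp only [Finset.mem_filter, Equiv.Perm.mem_support, Finset.mem_insert,
      Finset.mem_singleton]
    constructor
    · rintro ⟨_, h⟩
      have : j ∈ s(σ i, i) := h ▸ Sym2.mem_mk_right _ _
      exact Sym2.mem_iff.1 this
    · rintro (rfl | rfl)
      · rw [hσ]; exact ⟨hi'.symm, Sym2.eq_swap⟩
      · exact ⟨hi', rfl⟩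
  rw [this, Finset.card_pair hi']

/-- The involution exchanges the two ends of every edge of `M` and fixes the uncovered vertices. -/
theorem IsEdgeMatching.exists_perm {M : Finset (Sym2 W)} (hM : G.IsEdgeMatching M) :
    ∃ σ : Equiv.Perm W, G.IsMatchingPerm σ ∧ permEdges σ = M := by
  classical
  have huniq : ∀ i j k, s(i, j) ∈ M → s(i, k) ∈ M → j = k := by
    intro i j k hj hk
    by_contra hne
    exact hM.2 _ hj _ hk (fun h => hne (Sym2.congr_right.1 h)) i
      ⟨Sym2.mem_mk_left _ _, Sym2.mem_mk_left _ _⟩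
  let f : W → W := fun i => if h : ∃ j, s(i, j) ∈ M then h.choose else i
  have hf : ∀ i j, s(i, j) ∈ M → f i = j := by
    intro i j hij
    have h : ∃ j, s(i, j) ∈ M := ⟨j, hij⟩
    simp only [f, dif_pos h]
    exact huniq i _ _ h.choose_spec hij
  have hf' : ∀ i, f i ≠ i → s(f i, i) ∈ M := by
    intro i hi
    by_cases h : ∃ j, s(i, j) ∈ M
    · obtain ⟨j, hj⟩ := h
      rw [hf i j hj, Sym2.eq_swap]; exact hj
    · exact absurd (by simp only [f, dif_neg h]) hi
  have hinv : Function.Involutive f := by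
    intro i
    by_cases hi : f i = i
    · rw [hi, hi]
    · exact hf _ _ (hf' i hi)
  refine ⟨hinv.toPerm, ⟨hinv, fun i hi => hM.1 _ (hf' i hi)⟩, ?_⟩
  ext e
  induction e using Sym2.ind with
  | h i j =>
    rw [mem_permEdges_iff (σ := hinv.toPerm) (w := j) hinv (Sym2.mem_mk_right _ _)]
    simp only [Function.Involutive.coe_toPerm]
    constructor
    · rintro ⟨h, he⟩
      rw [he]; exact hf' j h
    · intro h
      have hadj : G.Adj i j := hM.1 _ h
      rw [hf j i (by rwa [Sym2.eq_swap])]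
      exact ⟨hadj.ne, rfl⟩

theorem sign_eq_of_involutive (hσ : ∀ i, σ (σ i) = i) :
    Equiv.Perm.sign σ = (-1) ^ (permEdges σ).card := by
  have h2 : σ ^ 2 = 1 := by ext i; simp [pow_two, hσ]
  rw [Equiv.Perm.sign_of_pow_two_eq_one h2, Equiv.Perm.card_fixedPoints,
    Equiv.Perm.sum_cycleType, card_support_eq hσ]
  have := card_support_eq hσ ▸ σ.support.card_le_univ
  congr 1
  omega

end Perm

variable [Fintype W]

open Classical in
theorem matchingPolynomial_eq_sum_matchings (G : SimpleGraph W) :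
    matchingPolynomial G = ∑ M : Finset (Sym2 W) with G.IsEdgeMatching M,
      (-1) ^ M.card * (X : ℝ[X]) ^ (Fintype.card W - 2 * M.card) := by
  rw [← Finset.sum_fiberwise_of_maps_to (g := Finset.card)
    (t := Finset.range (Fintype.card W / 2 + 1)), matchingPolynomial]
  · refine Finset.sum_congr rfl fun i _ => ?_
    have h : numMatchings G i =
        ((Finset.univ.filter fun M => G.IsEdgeMatching M).filter fun M => M.card = i).card := by
      rw [numMatchings, ← Set.ncard_coe_finset]
      congr 1
      ext M
      simp [IsEdgeMatching, and_comm]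
    rw [Finset.sum_congr rfl (g := fun _ =>
      (-1) ^ i * (X : ℝ[X]) ^ (Fintype.card W - 2 * i)) fun M hM => by
        rw [(Finset.mem_filter.1 hM).2], Finset.sum_const, ← h]
    simp
    ring
  · intro M hM
    obtain ⟨σ, hσ, rfl⟩ := (Finset.mem_filter.1 hM).2.exists_perm
    have := card_support_eq hσ.1 ▸ σ.support.card_le_univ
    simp only [Finset.mem_range]
    omega

open Classical in
theorem matchingPolynomial_eq_sum_perm [DecidableEq W] (G : SimpleGraph W) :
    matchingPolynomial G = ∑ σ : Equiv.Perm W with G.IsMatchingPerm σ,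
      (Equiv.Perm.sign σ : ℤ) • (X : ℝ[X]) ^ (Fintype.card W - σ.support.card) := by
  rw [matchingPolynomial_eq_sum_matchings]
  symm
  refine Finset.sum_bij (fun σ _ => permEdges σ) ?_ ?_ ?_ ?_
  · intro σ hσ
    simpa using (Finset.mem_filter.1 hσ).2.isEdgeMatching
  · intro σ hσ τ hτ h
    exact permEdges_injective (Finset.mem_filter.1 hσ).2.1 (Finset.mem_filter.1 hτ).2.1 h
  · intro M hM
    obtain ⟨σ, hσ, rfl⟩ := (Finset.mem_filter.1 hM).2.exists_perm
    exact ⟨σ, by simpa using hσ, rfl⟩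
  · intro σ hσ
    rw [sign_eq_of_involutive (Finset.mem_filter.1 hσ).2.1,
      card_support_eq (Finset.mem_filter.1 hσ).2.1]
    simp

section Charpoly

variable [DecidableEq W] {G : SimpleGraph W}

/-- Each transposition meets its edge twice, so the sign squares to 1; each fixed point gives a
factor `X`. -/
theorem prod_charmatrix_signedAdj {σ : Equiv.Perm W} (hσ : G.IsMatchingPerm σ)
    (T : Finset (Sym2 W)) :
    ∏ i, (G.signedAdj T).charmatrix (σ i) i = X ^ (Fintype.card W - σ.support.card) := by
  have h1 : ∏ i ∈ σ.support, (G.signedAdj T).charmatrix (σ i) i = 1 := by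
    refine Finset.prod_involution (fun i _ => σ i) ?_ ?_ ?_ ?_
    · intro i hi
      have hi' := Equiv.Perm.mem_support.1 hi
      rw [hσ.1 i, Matrix.charmatrix_apply_ne _ _ _ hi', Matrix.charmatrix_apply_ne _ _ _ hi'.symm]
      simp only [signedAdj, Matrix.of_apply, if_pos (hσ.2 i hi'), if_pos (hσ.2 i hi').symm]
      rw [neg_mul_neg, ← C_mul, Sym2.eq_swap, edgeSign_mul_self, C_1]
    · intro i hi _
      exact Equiv.Perm.mem_support.1 hi
    · intro i hi
      rw [Equiv.Perm.mem_support, hσ.1]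
      exact (Equiv.Perm.mem_support.1 hi).symm
    · intro i _
      exact hσ.1 i
  have h2 : ∏ i ∈ σ.supportᶜ, (G.signedAdj T).charmatrix (σ i) i =
      X ^ (Fintype.card W - σ.support.card) := by
    rw [← Finset.card_compl, ← Finset.prod_const]
    refine Finset.prod_congr rfl fun i hi => ?_
    have hi' : σ i = i := by simpa using hi
    rw [hi', Matrix.charmatrix_apply_eq]
    simp [signedAdj]
  rw [← Finset.prod_mul_prod_compl σ.support, h1, h2, one_mul]

theorem prod_charmatrix_eq_zero {σ : Equiv.Perm W} {i : W} (hi : σ i ≠ i) (h : ¬ G.Adj (σ i) i)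
    (T : Finset (Sym2 W)) : ∏ i, (G.signedAdj T).charmatrix (σ i) i = 0 := by
  refine Finset.prod_eq_zero (Finset.mem_univ i) ?_
  rw [Matrix.charmatrix_apply_ne _ _ _ hi]
  simp [signedAdj, h]

-- If `σ` is not an involution but moves points only along edges, some edge is used by exactly one
-- factor; flipping its sign pairs the signings into cancelling terms.
open Classical in
theorem sum_prod_charmatrix_eq_zero {σ : Equiv.Perm W} (hσ : ¬ G.IsMatchingPerm σ) :
    ∑ T ∈ G.edgeFinset.powerset, ∏ i, (G.signedAdj T).charmatrix (σ i) i = 0 := by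
  by_cases hadj : ∀ i, σ i ≠ i → G.Adj (σ i) i
  · obtain ⟨i, hi⟩ : ∃ i, σ (σ i) ≠ i := by
      by_contra! h
      exact hσ ⟨h, hadj⟩
    have hi' : σ i ≠ i := fun h => hi (by rw [h, h])
    have he : s(σ i, i) ∈ G.edgeFinset := by
      rw [mem_edgeFinset]; exact hadj i hi'
    have hflip : ∀ T : Finset (Sym2 W),
        ∏ j, (G.signedAdj (symmDiff T {s(σ i, i)})).charmatrix (σ j) j =
          -∏ j, (G.signedAdj T).charmatrix (σ j) j := by
      intro T
      rw [← Finset.mul_prod_erase _ _ (Finset.mem_univ i),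
        ← Finset.mul_prod_erase _ _ (Finset.mem_univ i), ← neg_mul]
      congr 1
      · rw [Matrix.charmatrix_apply_ne _ _ _ hi', Matrix.charmatrix_apply_ne _ _ _ hi']
        simp [signedAdj, hadj i hi', edgeSign_symmDiff]
      · refine Finset.prod_congr rfl fun j hj => ?_
        have hne : s(σ j, j) ≠ s(σ i, i) := by
          intro h
          rcases Sym2.eq_iff.1 h with ⟨_, h2⟩ | ⟨h1, h2⟩
          · exact (Finset.mem_erase.1 hj).1 h2
          · exact hi (h2 ▸ h1)
        simp only [Matrix.charmatrix_apply, signedAdj, Matrix.of_apply, edgeSign_symmDiff,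
          if_neg hne]
    refine Finset.sum_involution (fun T _ => symmDiff T {s(σ i, i)}) ?_ ?_ ?_ ?_
    · intro T _
      rw [hflip, add_neg_cancel]
    · intro T _ _ h
      have := symmDiff_eq_left.1 h
      simp at this
    · intro T hT
      rw [Finset.mem_powerset] at hT ⊢
      intro f hf
      rcases Finset.mem_symmDiff.1 hf with h | h
      · exact hT h.1
      · rw [Finset.mem_singleton.1 h.1]; exact he
    · intro T _
      exact symmDiff_symmDiff_cancel_right _ _
  · push Not at hadj
    obtain ⟨i, hi, h⟩ := hadj
    exact Finset.sum_eq_zero fun T _ => prod_charmatrix_eq_zero hi h T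

open Classical in
/-- The average characteristic polynomial over all signings is the matching polynomial (Godsil and
Gutman). -/
theorem sum_charpoly_signedAdj (G : SimpleGraph W) :
    ∑ T ∈ G.edgeFinset.powerset, (G.signedAdj T).charpoly =
      C (2 ^ G.edgeFinset.card) * matchingPolynomial G := by
  simp only [Matrix.charpoly, Matrix.det_apply]
  rw [Finset.sum_comm, matchingPolynomial_eq_sum_perm, Finset.mul_sum, Finset.sum_filter]
  refine Finset.sum_congr rfl fun σ _ => ?_
  rw [← Finset.smul_sum]
  split_ifs with hσ
  · rw [Finset.sum_congr rfl fun T _ => prod_charmatrix_signedAdj hσ T, Finset.sum_const,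
      Finset.card_powerset, Units.smul_def, mul_smul_comm]
    congr 1
    rw [nsmul_eq_mul, map_pow, map_ofNat]
    simp
  · rw [sum_prod_charmatrix_eq_zero hσ, smul_zero]

/-- The vector `e_u + t e_v` for an edge `uv`. -/
noncomputable def endVec (t : ℝ) (e : Sym2 W) : W → ℝ :=
  Pi.single (fstEnd e) 1 + t • Pi.single (sndEnd e) 1

open Classical in
theorem signedAdj_eq_sum (G : SimpleGraph W) (T : Finset (Sym2 W)) :
    G.signedAdj T =
      (∑ e ∈ G.edgeFinset, (Matrix.single (fstEnd e) (fstEnd e) 1 +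
        Matrix.single (sndEnd e) (sndEnd e) 1)) +
      ∑ e ∈ G.edgeFinset, if e ∈ T then -Matrix.vecMulVec (endVec 1 e) (endVec 1 e)
        else -Matrix.vecMulVec (endVec (-1) e) (endVec (-1) e) := by
  rw [← Finset.sum_add_distrib]
  -- For an edge $uv$ and $t=\pm1$, the matrix of $(e_u+te_v)(e_u+te_v)^T$ has diagonal entries 1 at
  -- $u$ and $v$ and off-diagonal entries $t$; subtracting it from the diagonal part leaves the sign
  -- $-t$ on the edge.
  have h : ∀ e ∈ G.edgeFinset, (Matrix.single (fstEnd e) (fstEnd e) 1 +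
      Matrix.single (sndEnd e) (sndEnd e) 1) +
      (if e ∈ T then -Matrix.vecMulVec (endVec 1 e) (endVec 1 e)
        else -Matrix.vecMulVec (endVec (-1) e) (endVec (-1) e)) =
      Matrix.of fun u v => if s(u, v) = e then edgeSign T e else 0 := by
    intro e he
    have hne : fstEnd e ≠ sndEnd e := by
      have h := mem_edgeFinset.1 he
      rw [← mk_ends e] at h
      exact (G.mem_edgeSet.1 h).ne
    ext u v
    have hiff : s(u, v) = e ↔
        (fstEnd e = u ∧ sndEnd e = v) ∨ (fstEnd e = v ∧ sndEnd e = u) := by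
      conv_lhs => rw [← mk_ends e]
      rw [Sym2.eq_iff]
      constructor <;> rintro (⟨rfl, rfl⟩ | ⟨rfl, rfl⟩) <;> simp
    simp only [Matrix.of_apply, hiff, edgeSign]
    by_cases hT : e ∈ T <;>
      simp only [hT, if_true, if_false, Matrix.add_apply, Matrix.neg_apply,
        Matrix.vecMulVec_apply, endVec, Matrix.single_apply, Pi.add_apply, Pi.smul_apply,
        Pi.single_apply, smul_eq_mul] <;>
      grind
  rw [Finset.sum_congr rfl h]
  ext u v
  simp only [signedAdj, Matrix.of_apply, Matrix.sum_apply, Finset.sum_ite_eq, mem_edgeFinset,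
    mem_edgeSet]

open Classical in
/-- For every `c`, some signing of `G` has at least as many eigenvalues `≥ c` as the matching
polynomial has roots `≥ c`. -/
theorem exists_signing_rootsGE_le (G : SimpleGraph W) (c : ℝ) :
    ∃ T : Finset (Sym2 W), RootCount.rootsGE (matchingPolynomial G) c ≤
      RootCount.rootsGE (G.signedAdj T).charpoly c := by
  set C₀ : Matrix W W ℝ := ∑ e ∈ G.edgeFinset, (Matrix.single (fstEnd e) (fstEnd e) 1 +
        Matrix.single (sndEnd e) (sndEnd e) 1) with hC₀
  have hsymm : C₀.IsSymm := by
    rw [Matrix.IsSymm, hC₀, Matrix.transpose_sum]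
    simp [Matrix.transpose_add, Matrix.transpose_single]
  obtain ⟨T, -, hT⟩ := Matrix.exists_choice_rootsGE_le (endVec 1) (endVec (-1)) G.edgeFinset
    hsymm c
  have hsum : Matrix.charpolySum (endVec 1) (endVec (-1)) G.edgeFinset C₀ =
      C (2 ^ G.edgeFinset.card) * matchingPolynomial G := by
    rw [← sum_charpoly_signedAdj, Matrix.charpolySum, powersetSum]
    exact Finset.sum_congr rfl fun T _ => by rw [signedAdj_eq_sum]
  refine ⟨T, ?_⟩
  rw [signedAdj_eq_sum]
  convert hT using 1
  rw [hsum, RootCount.rootsGE, RootCount.rootsGE, roots_C_mul _ (by positivity)]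

end Charpoly

end SimpleGraph

/-! ### Spectra of block matrices and of `N * Nᵀ` -/

namespace Matrix

variable {m n : Type*} [Fintype m] [Fintype n] [DecidableEq m]

/-- Conjugation by a unipotent block matrix makes it block triangular with diagonal blocks `P` and
`Q`. -/
theorem charpoly_fromBlocks_swap (P Q : Matrix m m ℝ) :
    (fromBlocks ((1 / 2 : ℝ) • (P + Q)) ((1 / 2 : ℝ) • (P - Q)) ((1 / 2 : ℝ) • (P - Q))
      ((1 / 2 : ℝ) • (P + Q))).charpoly = P.charpoly * Q.charpoly := by
  set M := fromBlocks ((1 / 2 : ℝ) • (P + Q)) ((1 / 2 : ℝ) • (P - Q)) ((1 / 2 : ℝ) • (P - Q))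
      ((1 / 2 : ℝ) • (P + Q)) with hM
  let L : Matrix (m ⊕ m) (m ⊕ m) ℝ := fromBlocks 1 0 1 1
  let L' : Matrix (m ⊕ m) (m ⊕ m) ℝ := fromBlocks 1 0 (-1) 1
  have hLL : L * L' = 1 := by simp [L, L', fromBlocks_multiply]
  have h1 : L' * (M * L) = fromBlocks P ((1 / 2 : ℝ) • (P - Q)) 0 Q := by
    simp only [hM, L, L', fromBlocks_multiply]
    congr 1 <;> · simp <;> module
  rw [← charpoly_fromBlocks_zero₂₁, ← h1, charpoly_mul_comm, Matrix.mul_assoc, hLL, Matrix.mul_one]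

theorem charpoly_sub_smul_one_roots {M : Matrix m m ℝ} (hM : M.charpoly.Splits) (t : ℝ) :
    (M - t • (1 : Matrix m m ℝ)).charpoly.roots = M.charpoly.roots.map (· - t) := by
  have h : M - t • (1 : Matrix m m ℝ) = M - scalar m t := by
    rw [smul_one_eq_diagonal, scalar_apply]
  rw [h, charpoly_sub_scalar]
  conv_lhs => rw [hM.eq_prod_roots_of_monic M.charpoly_monic]
  rw [multiset_prod_comp, Multiset.map_map,
    ← roots_multiset_prod_X_sub_C (M.charpoly.roots.map (· - t)), Multiset.map_map]
  congr 3
  funext x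
  simp
  ring

theorem charpoly_mul_transpose_splits (N : Matrix m n ℝ) : (N * Nᵀ).charpoly.Splits := by
  have := isHermitian_mul_conjTranspose_self N
  rw [conjTranspose_eq_transpose_of_trivial] at this
  exact this.splits_charpoly

theorem nonneg_of_mem_charpoly_mul_transpose_roots (N : Matrix m n ℝ) {x : ℝ}
    (hx : x ∈ (N * Nᵀ).charpoly.roots) : 0 ≤ x := by
  have h := posSemidef_self_mul_conjTranspose N
  rw [conjTranspose_eq_transpose_of_trivial] at h
  rw [h.isHermitian.roots_charpoly_eq_eigenvalues] at hx
  obtain ⟨i, -, rfl⟩ := Multiset.mem_map.1 hx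
  exact h.eigenvalues_nonneg i

variable [DecidableEq n]

theorem exists_charpoly_mul_transpose_roots (N : Matrix m n ℝ) :
    ∃ R : Multiset ℝ, R.card = min (Fintype.card m) (Fintype.card n) ∧
      (N * Nᵀ).charpoly.roots = Multiset.replicate (Fintype.card m - Fintype.card n) 0 + R := by
  rcases le_total (Fintype.card m) (Fintype.card n) with h | h
  · refine ⟨(N * Nᵀ).charpoly.roots, ?_, by simp [Nat.sub_eq_zero_of_le h]⟩
    rw [← (charpoly_mul_transpose_splits N).natDegree_eq_card_roots, charpoly_natDegree_eq_dim,
      min_eq_left h]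
  · refine ⟨(Nᵀ * N).charpoly.roots, ?_, ?_⟩
    · have := charpoly_mul_transpose_splits Nᵀ
      rw [transpose_transpose] at this
      rw [← this.natDegree_eq_card_roots, charpoly_natDegree_eq_dim, min_eq_right h]
    · rw [charpoly_mul_comm_of_le _ _ h, roots_mul
        (mul_ne_zero (pow_ne_zero _ X_ne_zero) (charpoly_monic _).ne_zero), roots_X_pow,
        Multiset.nsmul_singleton]

/-- Right multiplication of the characteristic matrix by `K` makes it block triangular. Powers of
`X` on both sides avoid comparing the sizes of `m` and `n`. -/
theorem charpoly_fromBlocks_transpose (N : Matrix m n ℝ) :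
    (fromBlocks 0 N Nᵀ 0).charpoly * X ^ Fintype.card m =
      expand ℝ 2 (N * Nᵀ).charpoly * X ^ Fintype.card n := by
  have h1 : expand ℝ 2 (N * Nᵀ).charpoly =
      (scalar m (X ^ 2 : ℝ[X]) - (N * Nᵀ).map C).det := by
    rw [charpoly, AlgHom.map_det]
    congr 1
    ext1 i j
    by_cases h : i = j
    · simp [h, -Matrix.map_mul]
    · simp [h, -Matrix.map_mul]
  let K : Matrix (m ⊕ n) (m ⊕ n) ℝ[X] := fromBlocks (scalar m X) 0 (Nᵀ.map C) 1
  have hK : K.det = X ^ Fintype.card m := by simp [K]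
  have h2 : charmatrix (fromBlocks 0 N Nᵀ 0) * K =
      fromBlocks (scalar m (X ^ 2 : ℝ[X]) - (N * Nᵀ).map C) (-N.map C) 0 (scalar n X) := by
    rw [charmatrix_fromBlocks, fromBlocks_multiply, charmatrix_zero, charmatrix_zero]
    congr 1
    · rw [← map_mul, ← pow_two, Matrix.map_mul, Matrix.neg_mul, sub_eq_add_neg]
    · simp
    · rw [Matrix.neg_mul, neg_add_eq_zero]
      ext1 i j
      rw [scalar_apply, scalar_apply, mul_diagonal, diagonal_mul, mul_comm]
    · simp
  rw [charpoly, ← hK, ← det_mul, h2, det_fromBlocks_zero₂₁, h1]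
  simp

theorem rootsGE_charpoly_fromBlocks (N : Matrix m n ℝ) {b : ℝ} (hb : 0 < b) :
    RootCount.rootsGE (fromBlocks 0 N Nᵀ 0).charpoly b =
      (N * Nᵀ).charpoly.roots.countP (b ^ 2 ≤ ·) := by
  set S := (N * Nᵀ).charpoly.roots with hS
  have h1 : expand ℝ 2 (N * Nᵀ).charpoly =
      ((S.map fun a => √a).map fun a => X - C a).prod *
        ((S.map fun a => -√a).map fun a => X - C a).prod := by
    conv_lhs => rw [(charpoly_mul_transpose_splits N).eq_prod_roots_of_monic (charpoly_monic _)]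
    rw [map_multiset_prod, Multiset.map_map, Multiset.map_map, Multiset.map_map,
      ← Multiset.prod_map_mul]
    refine congrArg _ (Multiset.map_congr rfl fun a ha => ?_)
    have := Real.sq_sqrt (nonneg_of_mem_charpoly_mul_transpose_roots N ha)
    simp only [Function.comp_apply, map_sub, expand_X, expand_C, map_neg]
    conv_lhs => rw [← this, map_pow]
    ring
  have hne : ∀ s : Multiset ℝ, (s.map fun a => X - C a).prod ≠ 0 := fun s =>
    (monic_multiset_prod_of_monic _ _ fun a _ => monic_X_sub_C a).ne_zero
  have h2 := congrArg roots (charpoly_fromBlocks_transpose N)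
  rw [roots_mul (mul_ne_zero (charpoly_monic _).ne_zero (pow_ne_zero _ X_ne_zero)), h1,
    roots_mul (mul_ne_zero (mul_ne_zero (hne _) (hne _)) (pow_ne_zero _ X_ne_zero)),
    roots_mul (mul_ne_zero (hne _) (hne _)), roots_multiset_prod_X_sub_C,
    roots_multiset_prod_X_sub_C, roots_X_pow, roots_X_pow] at h2
  have h3 := congrArg (Multiset.countP (b ≤ ·)) h2
  simp only [Multiset.countP_add, Multiset.countP_nsmul] at h3
  have h0 : Multiset.countP (b ≤ ·) ({0} : Multiset ℝ) = 0 :=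
    Multiset.countP_eq_zero.2 fun x hx => by rw [Multiset.mem_singleton.1 hx]; exact not_le.2 hb
  have hneg : Multiset.countP (b ≤ ·) (S.map fun a => -√a) = 0 := by
    rw [Multiset.countP_eq_zero]
    intro x hx
    obtain ⟨a, -, rfl⟩ := Multiset.mem_map.1 hx
    have := Real.sqrt_nonneg a
    linarith
  have hpos : Multiset.countP (b ≤ ·) (S.map fun a => √a) = S.countP (b ^ 2 ≤ ·) := by
    rw [Multiset.countP_map, Multiset.countP_eq_card_filter]
    congr 1
    exact Multiset.filter_congr fun a _ => Real.le_sqrt' hb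
  rw [h0, hneg, hpos] at h3
  simpa [RootCount.rootsGE] using h3

/-- If `N Nᵀ` has sufficiently many eigenvalues `≥ b²`, then all its eigenvalues are, apart from
the zeros forced by the shape of `N`. -/
theorem exists_roots_ge_sq (N : Matrix m n ℝ) {b : ℝ} (hb : 0 ≤ b)
    (hN : 0 < b → min (Fintype.card m) (Fintype.card n) ≤
      RootCount.rootsGE (fromBlocks 0 N Nᵀ 0).charpoly b) :
    ∃ R : Multiset ℝ, (∀ x ∈ R, b ^ 2 ≤ x) ∧
      (N * Nᵀ).charpoly.roots = Multiset.replicate (Fintype.card m - Fintype.card n) 0 + R := by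
  obtain ⟨R, hcard, hR⟩ := exists_charpoly_mul_transpose_roots N
  refine ⟨R, ?_, hR⟩
  -- For `b = 0` positive semidefiniteness suffices. For `b > 0` the forced zeros do not count, so
  -- all of `R` must be `≥ b ^ 2`.
  rcases hb.eq_or_lt with rfl | hb
  · intro x hx
    rw [zero_pow two_ne_zero]
    exact nonneg_of_mem_charpoly_mul_transpose_roots N (hR ▸ Multiset.mem_add.2 (Or.inr hx))
  · have h := hN hb
    rw [rootsGE_charpoly_fromBlocks N hb, hR, Multiset.countP_add, ← hcard] at h
    have h0 : Multiset.countP (b ^ 2 ≤ ·)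
        (Multiset.replicate (Fintype.card m - Fintype.card n) (0 : ℝ)) = 0 := by
      rw [Multiset.countP_eq_zero]
      intro x hx
      rw [Multiset.eq_of_mem_replicate hx, not_le]
      positivity
    rw [h0, zero_add] at h
    exact Multiset.countP_eq_card.1 (le_antisymm (Multiset.countP_le_card _ _) h)

end Matrix

theorem le_rootsGE_of_le_kthLargestRoot {p : ℝ[X]} {k : ℕ} {b : ℝ} (hb : 0 < b)
    (h : b ≤ kthLargestRoot p k) : k ≤ RootCount.rootsGE p b := by
  rcases k.eq_zero_or_pos with rfl | hk
  · exact Nat.zero_le _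
  set L := p.roots.sort (· ≥ ·) with hL
  have hlt : k - 1 < L.length := by
    -- Were there fewer than `k` roots, the default value 0 would contradict `0 < b`.
    by_contra! hle
    rw [kthLargestRoot, List.getD_eq_default _ _ hle] at h
    linarith
  rw [kthLargestRoot, List.getD_eq_getElem _ _ hlt] at h
  have hsorted : L.Pairwise (· ≥ ·) := p.roots.pairwise_sort _
  have htake : ∀ x ∈ L.take k, b ≤ x := by
    intro x hx
    obtain ⟨i, hi, rfl⟩ := List.getElem_of_mem hx
    rw [List.getElem_take]
    have hi' : i < k := by
      rw [List.length_take] at hi; omega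
    rcases (Nat.le_sub_one_of_lt hi').eq_or_lt with heq | hlt'
    · subst heq; exact h
    · exact h.trans (List.pairwise_iff_getElem.1 hsorted i (k - 1) _ hlt hlt')
  have h1 : (L.take k).countP (b ≤ ·) = k := by
    rw [List.countP_eq_length.2 (by simpa using htake), List.length_take]
    omega
  have h2 : RootCount.rootsGE p b = L.countP (b ≤ ·) := by
    rw [RootCount.rootsGE, ← Multiset.sort_eq p.roots (· ≥ ·), Multiset.coe_countP]
  rw [h2, ← h1]
  exact (List.take_sublist k L).countP_le

/-! ### Lifts and signed incidence matrices -/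

namespace MultiHypergraph

open scoped Matrix

variable {V : Type u} {E : Type v}

open Classical in
/-- The incidence matrix, with the entries at the incidences selected by `s` negated. -/
noncomputable def signedIncidence (H : MultiHypergraph V E) (s : V → E → Bool) : Matrix V E ℝ :=
  Matrix.of fun v e => if v ∈ H.edge e then (if s v e then -1 else 1) else 0

theorem signedAdj_incidenceGraph (H : MultiHypergraph V E) {T : Finset (Sym2 (V ⊕ E))}
    {s : V → E → Bool} (hs : ∀ v e, s v e = true ↔ s(Sum.inl v, Sum.inr e) ∈ T) :
    H.incidenceGraph.signedAdj T =
      Matrix.fromBlocks 0 (H.signedIncidence s) (H.signedIncidence s)ᵀ 0 := by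
  have h : ∀ v e, H.incidenceGraph.Adj (Sum.inl v) (Sum.inr e) ↔ v ∈ H.edge e := by
    simp [incidenceGraph]
  have key : ∀ v e, H.incidenceGraph.signedAdj T (Sum.inl v) (Sum.inr e) =
      H.signedIncidence s v e := by
    intro v e
    by_cases h1 : v ∈ H.edge e <;> by_cases h2 : s(Sum.inl v, Sum.inr e) ∈ T <;>
      simp [SimpleGraph.signedAdj, signedIncidence, SimpleGraph.edgeSign, h, hs, h1, h2]
  ext (u | u) (v | v)
  · simp [SimpleGraph.signedAdj, incidenceGraph]
  · exact key u v
  · rw [Matrix.fromBlocks_apply₂₁, Matrix.transpose_apply, ← key]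
    exact H.incidenceGraph.signedAdj_comm T _ _
  · simp [SimpleGraph.signedAdj, incidenceGraph]

variable [DecidableEq V]

/-- The `2`-covering of `H` in which the two sheets are exchanged at the incidences selected
by `s`. -/
def lift (H : MultiHypergraph V E) (s : V → E → Bool) :
    MultiHypergraph (V × Bool) (E × Bool) where
  edge e := (H.edge e.1).image fun v => (v, xor e.2 (s v e.1))

variable {H : MultiHypergraph V E} {s : V → E → Bool}

theorem mem_edge_lift {v : V} {a : Bool} {e : E} {b : Bool} :
    (v, a) ∈ (H.lift s).edge (e, b) ↔ v ∈ H.edge e ∧ a = xor b (s v e) := by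
  simp only [lift, Finset.mem_image, Prod.mk.injEq]
  constructor
  · rintro ⟨w, hw, rfl, rfl⟩
    exact ⟨hw, rfl⟩
  · rintro ⟨hv, rfl⟩
    exact ⟨v, hv, rfl, rfl⟩

/-- The projection of the lift. -/
def liftCovering (H : MultiHypergraph V E) (s : V → E → Bool) : Covering (H.lift s) H where
  onV := Prod.fst
  onE := Prod.fst
  image_edge e := by
    ext v
    simp [lift]
  surjective := Prod.fst_surjective
  bijOn_edgesAt := by
    rintro ⟨v, a⟩
    refine ⟨?_, ?_, ?_⟩
    · rintro ⟨e, b⟩ h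
      exact (mem_edge_lift.1 h).1
    · rintro ⟨e, b⟩ h ⟨e', b'⟩ h' (rfl : e = e')
      have h1 := (mem_edge_lift.1 h).2
      have h2 := (mem_edge_lift.1 h').2
      rw [h1] at h2
      rw [Bool.xor_left_inj.1 h2]
    · intro e he
      exact ⟨(e, xor a (s v e)), mem_edge_lift.2 ⟨he, by simp⟩, rfl⟩
  bijOn_edge := by
    rintro ⟨e, b⟩
    refine ⟨?_, ?_, ?_⟩
    · rintro ⟨v, a⟩ h
      exact (mem_edge_lift.1 h).1
    · rintro ⟨v, a⟩ h ⟨v', a'⟩ h' (rfl : v = v')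
      rw [(mem_edge_lift.1 h).2, (mem_edge_lift.1 h').2]
    · intro v hv
      exact ⟨(v, xor b (s v e)), mem_edge_lift.2 ⟨hv, rfl⟩, rfl⟩

theorem ncard_fst_fiber {α : Type*} (x : α) : {y : α × Bool | y.1 = x}.ncard = 2 := by
  have : {y : α × Bool | y.1 = x} = (fun b => (x, b)) '' Set.univ := by
    ext ⟨y, b⟩
    simp [eq_comm]
  rw [this, Set.ncard_image_of_injective _ (Prod.mk_right_injective x), Set.ncard_univ]
  simp

theorem liftCovering_isFold (H : MultiHypergraph V E) (s : V → E → Bool) :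
    (H.liftCovering s).IsFold 2 :=
  ⟨ncard_fst_fiber, ncard_fst_fiber⟩

variable [Fintype E]

theorem adjMatrix_eq {d : ℕ} (hd : ∀ v : V, (H.edgesAt v).ncard = d) :
    H.adjMatrix = H.signedIncidence (fun _ _ => false) *
      (H.signedIncidence fun _ _ => false)ᵀ - (d : ℝ) • (1 : Matrix V V ℝ) := by
  classical
  ext u v
  simp only [adjMatrix, Matrix.of_apply, Matrix.sub_apply, Matrix.mul_apply,
    Matrix.transpose_apply, signedIncidence, Matrix.smul_apply, smul_eq_mul]
  by_cases h : u = v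
  · subst h
    have : (Finset.univ.filter fun e : E => u ∈ H.edge e).card = d := by
      rw [← hd u, ← Set.ncard_coe_finset]
      congr 1
      ext e
      simp [edgesAt]
    simp [← this, ← ite_and]
  · simp [h, ← ite_and, and_comm]

/-- Functions equal on both sheets see the adjacency matrix of `H`; functions of opposite sign on
the sheets see its signed analogue. -/
theorem spec_lift [Fintype V] {d : ℕ} (hd : ∀ v : V, (H.edgesAt v).ncard = d) :
    (H.lift s).spec = H.spec + (H.signedIncidence s * (H.signedIncidence s)ᵀ -
      (d : ℝ) • (1 : Matrix V V ℝ)).charpoly.roots := by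
  classical
  have hd' : ∀ v : V × Bool, ((H.lift s).edgesAt v).ncard = d := fun v => by
    rw [((H.liftCovering s).bijOn_edgesAt v).ncard_eq, hd]
  have hblock : (H.lift s).adjMatrix.reindex
      ((Equiv.prodComm V Bool).trans (Equiv.boolProdEquivSum V))
      ((Equiv.prodComm V Bool).trans (Equiv.boolProdEquivSum V)) = Matrix.fromBlocks
        ((1 / 2 : ℝ) • (H.adjMatrix + (H.signedIncidence s * (H.signedIncidence s)ᵀ -
          (d : ℝ) • (1 : Matrix V V ℝ))))
        ((1 / 2 : ℝ) • (H.adjMatrix - (H.signedIncidence s * (H.signedIncidence s)ᵀ -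
          (d : ℝ) • (1 : Matrix V V ℝ))))
        ((1 / 2 : ℝ) • (H.adjMatrix - (H.signedIncidence s * (H.signedIncidence s)ᵀ -
          (d : ℝ) • (1 : Matrix V V ℝ))))
        ((1 / 2 : ℝ) • (H.adjMatrix + (H.signedIncidence s * (H.signedIncidence s)ᵀ -
          (d : ℝ) • (1 : Matrix V V ℝ)))) := by
    -- For an edge containing `u` and `v`, exactly one of its two lifts through `(u, a)` is
    -- relevant, and it meets `(v, b)` iff the product of the signs at `u` and `v` is 1 when `a =
    -- b`, or -1 when `a ≠ b`.
    have key : ∀ (u v : V) (a b : Bool),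
        ((H.lift s).signedIncidence (fun _ _ => false) *
          ((H.lift s).signedIncidence fun _ _ => false)ᵀ) (u, a) (v, b) =
        (1 / 2 : ℝ) * ((H.signedIncidence (fun _ _ => false) *
          (H.signedIncidence fun _ _ => false)ᵀ) u v + (if a = b then 1 else -1) *
          (H.signedIncidence s * (H.signedIncidence s)ᵀ) u v) := by
      intro u v a b
      simp only [Matrix.mul_apply, Matrix.transpose_apply, Fintype.sum_prod_type,
        Finset.mul_sum, ← Finset.sum_add_distrib]
      refine Finset.sum_congr rfl fun e _ => ?_
      simp only [signedIncidence, Matrix.of_apply, mem_edge_lift, Fintype.sum_bool]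
      by_cases hu : u ∈ H.edge e <;> by_cases hv : v ∈ H.edge e <;>
        cases a <;> cases b <;> cases s u e <;> cases s v e <;> simp [hu, hv] <;> norm_num
    rw [adjMatrix_eq hd', adjMatrix_eq hd]
    ext (u | u) (v | v) <;>
      simp only [Matrix.reindex_apply, Matrix.submatrix_apply, Matrix.sub_apply,
        Equiv.symm_trans_apply,
        Equiv.boolProdEquivSum_symm_apply, Equiv.prodComm_symm, Equiv.prodComm_apply,
        Sum.elim_inl, Sum.elim_inr, Prod.swap_prod_mk, key, Matrix.fromBlocks_apply₁₁,
        Matrix.fromBlocks_apply₁₂, Matrix.fromBlocks_apply₂₁, Matrix.fromBlocks_apply₂₂,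
        Matrix.smul_apply, Matrix.add_apply, Matrix.one_apply, Prod.mk.injEq, smul_eq_mul] <;>
      simp <;> ring
  rw [spec, spec, ← Matrix.charpoly_reindex
    ((Equiv.prodComm V Bool).trans (Equiv.boolProdEquivSum V)), hblock,
    Matrix.charpoly_fromBlocks_swap, roots_mul]
  exact mul_ne_zero (Matrix.charpoly_monic _).ne_zero (Matrix.charpoly_monic _).ne_zero

end MultiHypergraph

/-! ### The main theorem -/

theorem theorem1p5 {V : Type u} {E : Type v} [Fintype V] [DecidableEq V] [Nonempty V] [Fintype E]
    (H : MultiHypergraph V E) (d r : ℕ) (hd : 1 ≤ d) (hH : H.IsRegular d r)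
    (hroot : |Real.sqrt ((d : ℝ) - 1) - Real.sqrt ((r : ℝ) - 1)| ≤
      kthLargestRoot (matchingPolynomial H.incidenceGraph) H.tau) :
    ∃ (V' : Type u) (E' : Type v) (_ : Fintype V') (_ : DecidableEq V') (_ : Fintype E')
      (H' : MultiHypergraph V' E') (p : MultiHypergraph.Covering H' H),
      p.IsLeftSidedRamanujan d r := by
  classical
  set b := |Real.sqrt ((d : ℝ) - 1) - Real.sqrt ((r : ℝ) - 1)| with hb
  obtain ⟨T, hT⟩ := H.incidenceGraph.exists_signing_rootsGE_le b
  set s : V → E → Bool := fun v e => decide (s(Sum.inl v, Sum.inr e) ∈ T)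
  rw [H.signedAdj_incidenceGraph (s := s) fun v e => decide_eq_true_iff] at hT
  obtain ⟨R, hR, hroots⟩ := Matrix.exists_roots_ge_sq (H.signedIncidence s) (abs_nonneg _)
    (fun h => (le_rootsGE_of_le_kthLargestRoot h hroot).trans hT)
  refine ⟨V × Bool, E × Bool, inferInstance, inferInstance, inferInstance, H.lift s,
    H.liftCovering s, H.liftCovering_isFold s, _, R.map (· - (d : ℝ)),
    MultiHypergraph.spec_lift hH.degree_eq, ?_, ?_⟩
  · rw [Matrix.charpoly_sub_smul_one_roots (Matrix.charpoly_mul_transpose_splits _), hroots,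
      Multiset.map_add, Multiset.map_replicate, zero_sub, MultiHypergraph.obvious]
  · intro x hx
    obtain ⟨y, hy, rfl⟩ := Multiset.mem_map.1 hx
    have h1 : (0 : ℝ) ≤ (d : ℝ) - 1 := sub_nonneg.2 (by exact_mod_cast hd)
    have h2 : (0 : ℝ) ≤ (r : ℝ) - 1 := sub_nonneg.2 (by exact_mod_cast one_le_two.trans hH.two_le)
    have h3 := hR y hy
    -- Here $b^2=(d-1)+(r-1)-2\sqrt{d-1}\sqrt{r-1}$, and subtracting $d$ gives the required bound.
    rw [sq_abs, sub_sq, Real.sq_sqrt h1, Real.sq_sqrt h2] at h3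
    rw [Real.sqrt_mul h1]
    linarith
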